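/- Let $\mu$ be a Radon measure on the Euclidean plane $(\mathbb{R}^2,\|\cdot\|_2)$ that has no atoms (that is, $\mu(\{x\})=0$ for every $x$) and satisfies $\mu(\mathbb{R}^2)=\infty$. For a locally $\mu$-integrable function $f$ let $$M_\mu f(x)=\sup_{B\ni x,\ \mu(B)>0}\frac{1}{\mu(B)}\int_B |f|\,d\mu\in[0,\infty],\qquad x\in\mathbb{R}^2,$$ be its uncentered Hardy–Littlewood maximal function, where the supremum is over all open Euclidean balls $B$ that contain $x$ and have positive measure. Then for every $1<p<\infty$ and every $f\in L^p(\mu)$, $$\|M_\mu f\|_{L^p(\mu)}\ \ge\ \left(1+\frac{1}{5(p-1)}\right)^{1/p}\|f\|_{L^p(\mu)},$$ where the left-hand side may be $+\infty$. -/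

import Mathlib

open MeasureTheory
open scoped ENNReal

/-- The uncentered Hardy–Littlewood maximal function of `f` with respect to `μ`: at the point `x`,
the supremum of the averages `(1 / μ B) ∫_B |f| dμ` over all open balls `B` (with arbitrary centre
`c` and radius `r`) that contain `x` and have positive measure. It takes values in `[0, ∞]`. -/
noncomputable def uncenteredMaximal {X : Type*} [PseudoMetricSpace X] [MeasurableSpace X]
    (μ : Measure X) (f : X → ℝ) (x : X) : ℝ≥0∞ :=
  ⨆ (c : X) (r : ℝ) (_ : x ∈ Metric.ball c r) (_ : 0 < μ (Metric.ball c r)),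
    (μ (Metric.ball c r))⁻¹ * ∫⁻ y in Metric.ball c r, ‖f y‖ₑ ∂μ

open Metric Filter Topology

-- Let g = |f|, W = {Mg ≥ t} and A = {g > t}. Everything rests on the level estimate ∫ (g - t)⁺ dμ ≤
-- 5 t μ(W \ A), which is `lintegral_ofReal_sub_le`. As A ⊆ W almost everywhere, it gives ∫_A g dμ +
-- 4 t μ(A) ≤ 5 t μ(W). Integrating against p t^(p-2) dt yields (p/(p-1) + 4) ‖g‖^p ≤ 5 ‖Mg‖^p.
--
-- For the level estimate, cover almost all of A by discs over which g - t has integral zero. On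
-- such a disc the excess ∫ (g - t)⁺ equals the deficit ∫ (t - g)⁺. The deficit has density at most
-- t, vanishes on A and, up to null sets, sits in W. The factor 5 bounds the overlap of the discs.
--
-- The discs are chosen greedily by radius among limits of discs with mean above t; infinite total
-- mass keeps these radii locally bounded. No chosen disc contains the centre of another, so, off
-- finitely many points, a common point sees the centres under angles above π/3, which allows at
-- most five. Circles may carry mass, so the mean over a largest disc may jump past t. Only
-- countably many circles do, however, and a three-dimensional parameter ball minus a countable set
-- is connected. Hence the intermediate value theorem finds zero integrals arbitrarily near, and
-- Fatou's lemma in both directions passes to the limit.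

local notation "ℝ²" => EuclideanSpace ℝ (Fin 2)

/-! ### Circles charged by an atomless measure -/

/-- Two circles in the plane with different centres meet in at most two points. -/
theorem finite_sphere_inter_sphere {a b : ℝ²} (hab : a ≠ b) (r s : ℝ) :
    (sphere a r ∩ sphere b s).Finite := by
  by_contra hinf
  obtain ⟨t, hts, htc⟩ := Set.Infinite.exists_subset_card_eq hinf 3
  obtain ⟨x, y, z, hxy, hxz, hyz, rfl⟩ := Finset.card_eq_three.1 htc
  have hx := hts (show x ∈ (({x, y, z} : Finset ℝ²) : Set ℝ²) by simp)
  have hy := hts (show y ∈ (({x, y, z} : Finset ℝ²) : Set ℝ²) by simp)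
  have hz := hts (show z ∈ (({x, y, z} : Finset ℝ²) : Set ℝ²) by simp)
  rcases EuclideanGeometry.eq_of_dist_eq_of_dist_eq_of_finrank_eq_two
    (by simp) hab hxy hx.1 hy.1 hz.1 hx.2 hy.2 hz.2 with h | h
  · exact hxz h.symm
  · exact hyz h.symm

/-- Only countably many circles are charged by a measure without atoms. -/
theorem countable_sphere_pos (μ : Measure ℝ²) [SFinite μ] (hμ : ∀ x, μ {x} = 0) :
    {q : ℝ² × ℝ | 0 < μ (sphere q.1 q.2)}.Countable := by
  have : NullSingletonClass μ := ⟨fun x ↦ hμ x⟩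
  -- Distinct circles have null intersection, and an s-finite measure charges only countably many
  -- almost disjoint sets.
  refine Measure.countable_meas_pos_of_disjoint_iUnion₀
    (As := fun q : ℝ² × ℝ ↦ sphere q.1 q.2)
    (fun q ↦ isClosed_sphere.measurableSet.nullMeasurableSet) ?_
  rintro ⟨a, r⟩ ⟨b, s⟩ hne
  change μ (sphere a r ∩ sphere b s) = 0
  by_cases hab : a = b
  · subst hab
    have : sphere a r ∩ sphere a s = ∅ := by
      ext y
      simp only [Set.mem_inter_iff, mem_sphere, Set.mem_empty_iff_false, iff_false, not_and]
      rintro h1 h2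
      exact hne (by rw [← h1, ← h2])
    simp [this]
  · exact (finite_sphere_inter_sphere hab r s).measure_zero μ

/-! ### Integrals over converging balls -/

theorem eventually_mem_ball {E ι : Type*} [PseudoMetricSpace E] {l : Filter ι}
    {c : ι → E} {r : ι → ℝ} {c₀ y : E} {r₀ : ℝ}
    (hc : Tendsto c l (𝓝 c₀)) (hr : Tendsto r l (𝓝 r₀)) (hy : y ∈ ball c₀ r₀) :
    ∀ᶠ i in l, y ∈ ball (c i) (r i) :=
  (tendsto_const_nhds.dist hc).eventually_lt hr hy

theorem eventually_notMem_ball {E ι : Type*} [PseudoMetricSpace E] {l : Filter ι}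
    {c : ι → E} {r : ι → ℝ} {c₀ y : E} {r₀ : ℝ}
    (hc : Tendsto c l (𝓝 c₀)) (hr : Tendsto r l (𝓝 r₀)) (hy : y ∉ closedBall c₀ r₀) :
    ∀ᶠ i in l, y ∉ ball (c i) (r i) := by
  have hy' : r₀ < dist y c₀ := by simpa using hy
  filter_upwards [hr.eventually_lt (tendsto_const_nhds.dist hc) hy'] with i hi
  simpa using hi.le

section Limits

variable {E ι : Type*} [PseudoMetricSpace E] [ProperSpace E] [MeasurableSpace E] [BorelSpace E]

/-- Integrals over converging balls converge when the indicators of the balls do. -/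
theorem tendsto_setIntegral_ball {μ : Measure E} {h : E → ℝ} (hh : LocallyIntegrable h μ)
    {l : Filter ι} [l.IsCountablyGenerated] {c : ι → E} {r : ι → ℝ} {c₀ : E} {r₀ : ℝ} {S : Set E}
    (hS : MeasurableSet S) (hc : Tendsto c l (𝓝 c₀)) (hr : Tendsto r l (𝓝 r₀))
    (hae : ∀ᵐ y ∂μ, ∀ᶠ i in l, (y ∈ ball (c i) (r i) ↔ y ∈ S)) :
    Tendsto (fun i ↦ ∫ y in ball (c i) (r i), h y ∂μ) l (𝓝 (∫ y in S, h y ∂μ)) := by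
  simp_rw [← integral_indicator measurableSet_ball, ← integral_indicator hS]
  have hint : IntegrableOn h (closedBall c₀ (r₀ + 2)) μ :=
    hh.integrableOn_isCompact (isCompact_closedBall _ _)
  refine tendsto_integral_filter_of_dominated_convergence
    ((closedBall c₀ (r₀ + 2)).indicator fun y ↦ ‖h y‖) ?_ ?_ ?_ ?_
  · exact Eventually.of_forall fun i ↦
      hh.aestronglyMeasurable.indicator measurableSet_ball
  · have h1 : ∀ᶠ i in l, dist (c i) c₀ < 1 := hc (ball_mem_nhds _ one_pos)
    have h2 : ∀ᶠ i in l, r i < r₀ + 1 := hr (Iio_mem_nhds (by linarith))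
    filter_upwards [h1, h2] with i h1 h2
    refine Eventually.of_forall fun y ↦ ?_
    rw [norm_indicator_eq_indicator_norm]
    refine Set.indicator_le_indicator_of_subset ?_ (fun _ ↦ norm_nonneg _) y
    intro z hz
    rw [mem_ball] at hz
    rw [mem_closedBall]
    linarith [dist_triangle z (c i) c₀]
  · exact (integrable_indicator_iff isClosed_closedBall.measurableSet).2 hint.norm
  · filter_upwards [hae] with y hy
    refine tendsto_const_nhds.congr' ?_
    filter_upwards [hy] with i hi
    by_cases hyS : y ∈ S
    · rw [Set.indicator_of_mem hyS, Set.indicator_of_mem (hi.2 hyS)]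
    · rw [Set.indicator_of_notMem hyS, Set.indicator_of_notMem (fun h ↦ hyS (hi.1 h))]

/-- Membership of a point off the limiting sphere is eventually constant, so only the mass of that
sphere could obstruct continuity. -/
theorem continuousAt_setIntegral_ball {μ : Measure E} {h : E → ℝ} (hh : LocallyIntegrable h μ)
    {q : E × ℝ} (hq : μ (sphere q.1 q.2) = 0) :
    ContinuousAt (fun q : E × ℝ ↦ ∫ y in ball q.1 q.2, h y ∂μ) q := by
  refine tendsto_setIntegral_ball hh measurableSet_ball continuousAt_fst continuousAt_snd ?_
  filter_upwards [measure_eq_zero_iff_ae_notMem.1 hq] with y hy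
  by_cases hyb : y ∈ ball q.1 q.2
  · filter_upwards [eventually_mem_ball continuousAt_fst continuousAt_snd hyb] with i hi
    simp only [hyb, hi]
  · have : y ∉ closedBall q.1 q.2 := fun h ↦ by
      rw [← ball_union_sphere] at h
      exact h.elim hyb hy
    filter_upwards [eventually_notMem_ball continuousAt_fst continuousAt_snd this] with i hi
    simp only [hyb, hi]

theorem tendsto_setIntegral_ball_left {μ : Measure E} {h : E → ℝ} (hh : LocallyIntegrable h μ)
    (c : E) (r : ℝ) :
    Tendsto (fun s ↦ ∫ y in ball c s, h y ∂μ) (𝓝[<] r) (𝓝 (∫ y in ball c r, h y ∂μ)) := by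
  refine tendsto_setIntegral_ball hh measurableSet_ball tendsto_const_nhds
    (tendsto_id.mono_left nhdsWithin_le_nhds) (Eventually.of_forall fun y ↦ ?_)
  by_cases hy : y ∈ ball c r
  · filter_upwards [eventually_mem_ball tendsto_const_nhds
      (tendsto_id.mono_left nhdsWithin_le_nhds) hy] with s hs
    exact ⟨fun _ ↦ hy, fun _ ↦ hs⟩
  · filter_upwards [self_mem_nhdsWithin] with s hs
    exact ⟨fun h ↦ ball_subset_ball (le_of_lt hs) h, fun h ↦ absurd h hy⟩

theorem tendsto_setIntegral_ball_right {μ : Measure E} {h : E → ℝ} (hh : LocallyIntegrable h μ)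
    (c : E) (r : ℝ) :
    Tendsto (fun s ↦ ∫ y in ball c s, h y ∂μ) (𝓝[>] r)
      (𝓝 (∫ y in closedBall c r, h y ∂μ)) := by
  refine tendsto_setIntegral_ball hh isClosed_closedBall.measurableSet tendsto_const_nhds
    (tendsto_id.mono_left nhdsWithin_le_nhds) (Eventually.of_forall fun y ↦ ?_)
  by_cases hy : y ∈ closedBall c r
  · filter_upwards [self_mem_nhdsWithin] with s hs
    exact ⟨fun _ ↦ hy, fun _ ↦ closedBall_subset_ball hs hy⟩
  · filter_upwards [eventually_notMem_ball tendsto_const_nhds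
      (tendsto_id.mono_left nhdsWithin_le_nhds) hy] with s hs
    exact ⟨fun h ↦ absurd h hs, fun h ↦ absurd h hy⟩

end Limits

/-! ### Nearby discs with zero integral -/

/-- Removing countably many points from a ball in a space of dimension `> 1` leaves a connected
set. -/
theorem isPreconnected_ball_diff_countable {V : Type*} [NormedAddCommGroup V] [NormedSpace ℝ V]
    (hV : 1 < Module.rank ℝ V) {C : Set V} (hC : C.Countable) (x : V) {r : ℝ} (hr : 0 < r) :
    IsPreconnected (ball x r \ C) := by
  let e := OpenPartialHomeomorph.univBall x r
  have hsrc : e.source = Set.univ := OpenPartialHomeomorph.univBall_source x r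
  have htgt : e.target = ball x r := OpenPartialHomeomorph.univBall_target x hr
  have hinj : Function.Injective e := fun a b h ↦
    e.injOn (by simp [hsrc]) (by simp [hsrc]) h
  have hcont : Continuous e := OpenPartialHomeomorph.continuous_univBall x r
  have hpre : (e ⁻¹' C).Countable := hC.preimage_of_injOn hinj.injOn
  have := (hpre.isConnected_compl_of_one_lt_rank hV).isPreconnected.image e hcont.continuousOn
  convert this using 1
  ext y
  constructor
  · rintro ⟨hy, hyC⟩
    rw [← htgt] at hy
    exact ⟨e.symm y, by simpa [e.right_inv hy] using hyC, e.right_inv hy⟩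
  · rintro ⟨z, hz, rfl⟩
    exact ⟨htgt ▸ e.map_source (by simp [hsrc]), hz⟩

/-- If balls with positive integral accumulate at `(x, R)`, but not at `(x, r)` for `r > R`, then
there are balls with vanishing integral arbitrarily near to `(x, R)`. -/
theorem exists_setIntegral_ball_eq_zero {μ : Measure ℝ²} [IsLocallyFiniteMeasure μ]
    (hμ : ∀ x, μ {x} = 0) {h : ℝ² → ℝ} (hh : LocallyIntegrable h μ) {q : ℝ² × ℝ}
    (hq : q ∈ closure {q : ℝ² × ℝ | 0 < ∫ y in ball q.1 q.2, h y ∂μ})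
    (hmax : ∀ r > q.2, (q.1, r) ∉ closure {q : ℝ² × ℝ | 0 < ∫ y in ball q.1 q.2, h y ∂μ})
    {ε : ℝ} (hε : 0 < ε) :
    ∃ d ∈ ball q ε, ∫ y in ball d.1 d.2, h y ∂μ = 0 := by
  set Φ : ℝ² × ℝ → ℝ := fun q ↦ ∫ y in ball q.1 q.2, h y ∂μ with hΦ
  set C := {q : ℝ² × ℝ | 0 < μ (sphere q.1 q.2)} with hCdef
  have hC : C.Countable := countable_sphere_pos μ hμ
  have hCr : ∀ c : ℝ², {r : ℝ | (c, r) ∈ C}.Countable := fun c ↦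
    hC.preimage_of_injOn (f := fun r : ℝ ↦ (c, r)) (fun _ _ _ _ h ↦ (Prod.ext_iff.1 h).2)
  have hrank : 1 < Module.rank ℝ (ℝ² × ℝ) := by
    rw [← Module.finrank_eq_rank, Module.finrank_prod]
    simp
  have hpre := isPreconnected_ball_diff_countable hrank hC q hε
  -- Shrinking the radius slightly keeps the integral positive, by continuity from the left, and
  -- leaves room to avoid `C`.
  obtain ⟨a, haU, haC, ha⟩ : ∃ a ∈ ball q ε, a ∉ C ∧ 0 < Φ a := by
    obtain ⟨⟨c, r⟩, hcr, hcrU⟩ := mem_closure_iff_nhds.1 hq _ (ball_mem_nhds q hε)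
    have e1 : ∀ᶠ s in 𝓝[<] r, 0 < Φ (c, s) :=
      (tendsto_setIntegral_ball_left hh c r) (Ioi_mem_nhds hcrU)
    have e2 : ∀ᶠ s in 𝓝[<] r, (c, s) ∈ ball q ε :=
      nhdsWithin_le_nhds ((Continuous.prodMk_right c).continuousAt (isOpen_ball.mem_nhds hcr))
    obtain ⟨t, htr, ht⟩ := (mem_nhdsLT_iff_exists_Ioo_subset).1 (e1.and e2)
    obtain ⟨s, hs, hsC⟩ := ((hCr c).dense_compl ℝ).exists_between htr
    exact ⟨(c, s), (ht hsC).2, hs, (ht hsC).1⟩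
  -- Every larger concentric disc has nonpositive integral by `hmax`.
  obtain ⟨b, hbU, hbC, hb⟩ : ∃ b ∈ ball q ε, b ∉ C ∧ Φ b ≤ 0 := by
    obtain ⟨s, hs, hsC⟩ := ((hCr q.1).dense_compl ℝ).exists_between
      (show q.2 < q.2 + ε by linarith)
    refine ⟨(q.1, s), ?_, hs, ?_⟩
    · rw [mem_ball, Prod.dist_eq, dist_self, Real.dist_eq]
      simp only [sup_lt_iff]
      exact ⟨hε, by rw [abs_of_pos (by linarith [hsC.1])]; linarith [hsC.2]⟩
    · by_contra! hpos
      exact hmax s hsC.1 (subset_closure hpos)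
  have hcont : ContinuousOn Φ (ball q ε \ C) := fun z hz ↦
    (continuousAt_setIntegral_ball hh (by simpa [hCdef] using hz.2)).continuousWithinAt
  obtain ⟨d, hd, hd0⟩ := hpre.intermediate_value ⟨hbU, hbC⟩ ⟨haU, haC⟩ hcont ⟨hb, ha.le⟩
  exact ⟨d, hd.1, hd0⟩

/-! ### Overlap of separated discs -/

/-- At most five nonzero complex numbers can pairwise enclose angles larger than `π / 3`. -/
theorem card_le_five_of_re_mul_conj_lt {ι : Type*} (S : Finset ι) (z : ι → ℂ)
    (hz : ∀ i ∈ S, z i ≠ 0)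
    (hS : ∀ i ∈ S, ∀ j ∈ S, i ≠ j →
      (z i * (starRingEnd ℂ) (z j)).re < ‖z i‖ * ‖z j‖ / 2) : S.card ≤ 5 := by
  classical
  by_contra! hcard
  obtain ⟨k, hk⟩ : S.Nonempty := Finset.card_pos.1 (by omega)
  have hπ := Real.pi_pos
  have hcos : ∀ θ : ℝ, |θ| ≤ Real.pi / 3 → 1 / 2 ≤ Real.cos θ := fun θ hθ ↦ by
    rw [← Real.cos_abs, ← Real.cos_pi_div_three]
    exact Real.cos_le_cos_of_nonneg_of_le_pi (abs_nonneg _) (by linarith) hθ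
  let θ : ι → ℝ := fun i ↦ (z i / z k).arg
  have hdiff : ∀ i ∈ S, ∀ j ∈ S, i ≠ j → ¬ |θ i - θ j| ≤ Real.pi / 3 := by
    intro i hi j hj hij hle
    have hzk := hz k hk
    have hpos : 0 < ‖z i‖ * ‖z j‖ :=
      mul_pos (norm_pos_iff.2 (hz i hi)) (norm_pos_iff.2 (hz j hj))
    have h1 : (z i * (starRingEnd ℂ) (z j)).re = ‖z i‖ * ‖z j‖ * Real.cos (θ i - θ j) := by
      have e : ∀ l, z l = z k * (‖z l / z k‖ * Complex.exp (θ l * Complex.I)) := fun l ↦ by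
        rw [Complex.norm_mul_exp_arg_mul_I]
        field_simp
      have e2 : z i * (starRingEnd ℂ) (z j) =
          ((‖z i‖ * ‖z j‖ : ℝ) : ℂ) * Complex.exp ((θ i - θ j : ℝ) * Complex.I) := by
        conv_lhs => rw [e i, e j]
        rw [map_mul, map_mul, Complex.conj_ofReal, ← Complex.exp_conj, map_mul,
          Complex.conj_ofReal, Complex.conj_I, norm_div, norm_div]
        rw [show ((θ i - θ j : ℝ) : ℂ) * Complex.I = θ i * Complex.I + θ j * -Complex.I by
          push_cast; ring, Complex.exp_add]
        have hk2 : z k * (starRingEnd ℂ) (z k) = (‖z k‖ : ℂ) ^ 2 := Complex.mul_conj' _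
        have hk0 : (‖z k‖ : ℂ) ≠ 0 := by simpa using hzk
        push_cast
        field_simp
        rw [← hk2]
        ring
      rw [e2, Complex.re_ofReal_mul, Complex.exp_ofReal_mul_I_re]
    have h2 := hS i hi j hj hij
    rw [h1] at h2
    nlinarith [hcos _ hle]
  have hθk : θ k = 0 := by simp [θ]
  -- Measured from `z k`, the other arguments exceed π/3 in absolute value. What remains of the
  -- circle splits into four sectors of width π/3, too few for five vectors.
  let s : ι → Fin 4 := fun i ↦
    if 2 * Real.pi / 3 < θ i then 0 else if 0 < θ i then 1 else
      if θ i ≤ -(2 * Real.pi / 3) then 2 else 3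
  obtain ⟨i, hi, j, hj, hij, hs⟩ := Finset.exists_ne_map_eq_of_card_lt_of_maps_to
    (s := S.erase k) (t := Finset.univ) (f := s)
    (by rw [Finset.card_erase_of_mem hk, Finset.card_univ, Fintype.card_fin]; omega)
    (fun _ _ ↦ by simp)
  rw [Finset.mem_erase] at hi hj
  have hi0 := hdiff i hi.2 k hk hi.1
  have hj0 := hdiff j hj.2 k hk hj.1
  have hij' := hdiff i hi.2 j hj.2 hij
  rw [hθk, sub_zero] at hi0 hj0
  have b1 : θ i ≤ Real.pi := Complex.arg_le_pi _
  have b2 : -Real.pi < θ i := Complex.neg_pi_lt_arg _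
  have b3 : θ j ≤ Real.pi := Complex.arg_le_pi _
  have b4 : -Real.pi < θ j := Complex.neg_pi_lt_arg _
  rw [abs_le, not_and_or, not_le, not_le] at hi0 hj0
  refine hij' (abs_le.2 ?_)
  simp only [s] at hs
  split_ifs at hs <;> rcases hi0 with hi0 | hi0 <;> rcases hj0 with hj0 | hj0 <;>
    first
    | exact absurd hs (by decide)
    | constructor <;> linarith

/-- At most five nonzero vectors in the plane can pairwise enclose angles larger than `π / 3`. -/
theorem card_le_five_of_inner_lt {ι : Type*} (S : Finset ι) (v : ι → ℝ²)
    (hv : ∀ i ∈ S, v i ≠ 0)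
    (hS : ∀ i ∈ S, ∀ j ∈ S, i ≠ j → inner ℝ (v i) (v j) < ‖v i‖ * ‖v j‖ / 2) :
    S.card ≤ 5 := by
  let e := Complex.orthonormalBasisOneI.repr.symm
  refine card_le_five_of_re_mul_conj_lt S (fun i ↦ e (v i)) (fun i hi ↦ by simpa using hv i hi) ?_
  intro i hi j hj hij
  have := hS j hj i hi hij.symm
  rw [← e.inner_map_map, ← e.norm_map (v i), ← e.norm_map (v j), Complex.inner] at this
  change (e (v i) * (starRingEnd ℂ) (e (v j))).re < ‖e (v i)‖ * ‖e (v j)‖ / 2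
  rwa [mul_comm ‖e (v i)‖]

/-- If neither of two discs contains the centre of the other one in its interior, then a common
point sees the centres under an angle larger than `π / 3`, unless it lies on both circles. -/
theorem inner_lt_of_mem_closedBall {V : Type*} [NormedAddCommGroup V] [InnerProductSpace ℝ V]
    {v w : V} {r s : ℝ} (hv : v ≠ 0) (hw : w ≠ 0) (hvr : ‖v‖ ≤ r) (hws : ‖w‖ ≤ s)
    (hr : r ≤ ‖v - w‖) (hs : s ≤ ‖v - w‖) (hne : ¬ (‖v‖ = r ∧ ‖w‖ = s)) :
    inner ℝ v w < ‖v‖ * ‖w‖ / 2 := by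
  by_contra! hle
  have h := norm_sub_sq_real v w
  have ha : 0 < ‖v‖ := norm_pos_iff.2 hv
  have hb : 0 < ‖w‖ := norm_pos_iff.2 hw
  generalize inner ℝ v w = t at *
  generalize ‖v‖ = a at *
  generalize ‖w‖ = b at *
  generalize ‖v - w‖ = d at *
  have had : a ≤ d := hvr.trans hr
  have hbd : b ≤ d := hws.trans hs
  have hd : d ^ 2 ≤ a ^ 2 + b ^ 2 - a * b := by linarith
  -- For positive a, b one has a² + b² - ab ≤ max(a, b)², with equality only if a = b. Since a, b ≤
  -- d, the triangle must be equilateral.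
  have hab : a = b := by
    rcases le_total a b with h' | h' <;> nlinarith
  subst hab
  have : d = a := by nlinarith
  exact hne ⟨by linarith, by linarith⟩

/-- Discs none of which contains the centre of another one in its interior overlap at most five
times, up to finitely many points. -/
theorem exists_finite_forall_card_le_five (S : Finset (ℝ² × ℝ)) (hpos : ∀ q ∈ S, 0 < q.2)
    (hS : ∀ p ∈ S, ∀ q ∈ S, p ≠ q → p.2 ≤ dist p.1 q.1) :
    ∃ Z : Set ℝ², Z.Finite ∧ ∀ y ∉ Z, ∀ T ⊆ S,
      (∀ q ∈ T, y ∈ closedBall q.1 q.2) → T.card ≤ 5 := by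
  classical
  -- The exceptional points are the centres, where directions degenerate, and the points on two
  -- circles, where the angle may equal π/3.
  refine ⟨(⋃ p ∈ S, {p.1}) ∪ ⋃ p ∈ S, ⋃ q ∈ S, ⋃ (_ : p ≠ q), sphere p.1 p.2 ∩ sphere q.1 q.2,
    ?_, ?_⟩
  · refine (S.finite_toSet.biUnion fun p _ ↦ Set.finite_singleton _).union
      (S.finite_toSet.biUnion fun p hp ↦ S.finite_toSet.biUnion fun q hq ↦
        Set.finite_iUnion fun hpq ↦ finite_sphere_inter_sphere (fun h ↦ ?_) _ _)
    have := hS p hp q hq hpq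
    rw [h, dist_self] at this
    exact absurd (hpos p hp) this.not_gt
  · intro y hy T hT hyT
    simp only [Set.mem_union, Set.mem_iUnion, Set.mem_singleton_iff, not_or, not_exists] at hy
    have hne : ∀ p ∈ T, p.1 - y ≠ 0 := fun p hp h ↦ hy.1 p (hT hp) (sub_eq_zero.1 h).symm
    have hn : ∀ p : ℝ² × ℝ, ‖p.1 - y‖ = dist y p.1 := fun p ↦ by rw [dist_comm, dist_eq_norm]
    refine card_le_five_of_inner_lt T (fun q ↦ q.1 - y) hne fun p hp q hq hpq ↦ ?_
    refine inner_lt_of_mem_closedBall (r := p.2) (s := q.2) (hne p hp) (hne q hq) ?_ ?_ ?_ ?_ ?_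
    · rw [hn]; exact hyT p hp
    · rw [hn]; exact hyT q hq
    · rw [sub_sub_sub_cancel_right, ← dist_eq_norm]; exact hS p (hT hp) q (hT hq) hpq
    · rw [sub_sub_sub_cancel_right, ← dist_eq_norm, dist_comm]
      exact hS q (hT hq) p (hT hp) hpq.symm
    · rw [hn, hn]
      exact fun h ↦ hy.2 p (hT hp) q (hT hq) hpq h

/-! ### Greedy selection of balls -/

/-- Greedy selection from a compact family of balls with radii bounded below. -/
theorem exists_finset_separated_cover {X : Type*} [MetricSpace X] {P : Set (X × ℝ)}
    (hP : IsCompact P) {δ : ℝ} (hδ : 0 < δ) (hPδ : ∀ q ∈ P, δ ≤ q.2) :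
    ∃ S : Finset (X × ℝ), (∀ q ∈ S, q ∈ P) ∧
      (∀ p ∈ S, ∀ q ∈ S, p ≠ q → p.2 ≤ dist p.1 q.1) ∧
      (∀ q ∈ S, ∀ r, (q.1, r) ∈ P → r ≤ q.2) ∧
      ∀ p ∈ P, ∃ q ∈ S, p.1 ∈ ball q.1 q.2 := by
  classical
  by_contra! hcon
  -- If no selection covers, the greedy choice never stops. The last clause is its invariant: a
  -- chosen radius is at least that of every pair whose centre is still uncovered.
  have key : ∀ n : ℕ, ∃ S : Finset (X × ℝ), S.card = n ∧ (∀ q ∈ S, q ∈ P) ∧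
      (∀ p ∈ S, ∀ q ∈ S, p ≠ q → p.2 ≤ dist p.1 q.1) ∧
      (∀ q ∈ S, ∀ r, (q.1, r) ∈ P → r ≤ q.2) ∧
      ∀ q ∈ S, ∀ p ∈ P, (∀ s ∈ S, p.1 ∉ ball s.1 s.2) → p.2 ≤ q.2 := by
    intro n
    induction n with
    | zero => exact ⟨∅, by simp⟩
    | succ n ih =>
      obtain ⟨S, hcard, hSP, hsep, hmax, hbound⟩ := ih
      obtain ⟨p₀, hp₀P, hp₀⟩ := hcon S hSP hsep hmax
      let Q := P ∩ ⋂ s ∈ S, {p : X × ℝ | p.1 ∉ ball s.1 s.2}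
      have hQ : IsCompact Q := hP.inter_right <| isClosed_biInter fun s _ ↦
        (isOpen_ball.preimage continuous_fst).isClosed_compl
      have hmemQ : ∀ p, p ∈ Q ↔ p ∈ P ∧ ∀ s ∈ S, p.1 ∉ ball s.1 s.2 := fun p ↦ by simp [Q]
      obtain ⟨q, hqQ, hq⟩ := hQ.exists_isMaxOn ⟨p₀, (hmemQ _).2 ⟨hp₀P, hp₀⟩⟩
        continuous_snd.continuousOn
      obtain ⟨hqP, hqS⟩ := (hmemQ q).1 hqQ
      have hqnS : q ∉ S := fun h ↦
        hqS q h (mem_ball_self (hδ.trans_le (hPδ q hqP)))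
      have hd : ∀ s ∈ S, s.2 ≤ dist q.1 s.1 := fun s hs ↦ by simpa using hqS s hs
      refine ⟨insert q S, by rw [Finset.card_insert_of_notMem hqnS, hcard], ?_, ?_, ?_, ?_⟩
      · simpa [Finset.forall_mem_insert] using ⟨hqP, fun a b h ↦ hSP (a, b) h⟩
      · intro a ha b hb hab
        rcases Finset.mem_insert.1 ha with rfl | ha' <;>
          rcases Finset.mem_insert.1 hb with rfl | hb'
        · exact absurd rfl hab
        · exact (hbound b hb' _ hqP hqS).trans (hd b hb')
        · rw [dist_comm]; exact hd a ha'
        · exact hsep a ha' b hb' hab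
      · intro a ha r hr
        rcases Finset.mem_insert.1 ha with rfl | ha
        · exact hq ((hmemQ _).2 ⟨hr, hqS⟩)
        · exact hmax a ha r hr
      · intro a ha p hpP hp
        have hpS : ∀ s ∈ S, p.1 ∉ ball s.1 s.2 := fun s hs ↦ hp s (Finset.mem_insert_of_mem hs)
        rcases Finset.mem_insert.1 ha with rfl | ha
        · exact hq ((hmemQ _).2 ⟨hpP, hpS⟩)
        · exact hbound a ha p hpP hpS
  -- Chosen centres are δ-separated, so each ball of radius δ/2 in a finite cover holds at most one.
  obtain ⟨t, -, htfin, ht⟩ :=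
    finite_cover_balls_of_compact (hP.image continuous_fst) (half_pos hδ)
  obtain ⟨S, hcard, hSP, hsep, -, -⟩ := key (htfin.toFinset.card + 1)
  have hex : ∀ q : X × ℝ, ∃ c, q ∈ S → c ∈ t ∧ q.1 ∈ ball c (δ / 2) := fun q ↦ by
    by_cases hq : q ∈ S
    · obtain ⟨c, hc, hqc⟩ := Set.mem_iUnion₂.1 (ht ⟨q, hSP q hq, rfl⟩)
      exact ⟨c, fun _ ↦ ⟨hc, hqc⟩⟩
    · exact ⟨q.1, fun h ↦ absurd h hq⟩
  choose c hc using hex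
  obtain ⟨a, ha, b, hb, hab, heq⟩ := Finset.exists_ne_map_eq_of_card_lt_of_maps_to
    (s := S) (t := htfin.toFinset) (f := c) (by omega) (fun q hq ↦ by simpa using (hc q hq).1)
  have h1 := mem_ball.1 (hc a ha).2
  have h2 := mem_ball'.1 (hc b hb).2
  rw [heq] at h1
  have h3 := hsep a ha b hb hab
  have h4 := hPδ a (hSP a ha)
  linarith [dist_triangle a.1 (c b) b.1]

/-! ### Basic properties of the maximal function -/

section MaximalFunction

variable {X : Type*} [PseudoMetricSpace X] [MeasurableSpace X] {μ : Measure X}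

theorem le_uncenteredMaximal {f : X → ℝ} {c x : X} {r : ℝ} (hx : x ∈ ball c r)
    (hpos : 0 < μ (ball c r)) :
    (μ (ball c r))⁻¹ * ∫⁻ y in ball c r, ‖f y‖ₑ ∂μ ≤ uncenteredMaximal μ f x :=
  le_iSup_of_le c <| le_iSup_of_le r <| le_iSup_of_le hx <| le_iSup_of_le hpos le_rfl

/-- Superlevel sets are open: a ball witnessing a large average at one point does so at all of its
points. -/
theorem measurable_uncenteredMaximal [BorelSpace X] (f : X → ℝ) :
    Measurable (uncenteredMaximal μ f) := by
  refine measurable_of_Ioi fun t ↦ IsOpen.measurableSet ?_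
  rw [isOpen_iff_mem_nhds]
  intro x hx
  simp only [Set.mem_preimage, Set.mem_Ioi, uncenteredMaximal, lt_iSup_iff] at hx
  obtain ⟨c, r, hxc, hpos, hlt⟩ := hx
  filter_upwards [isOpen_ball.mem_nhds hxc] with y hy
  exact hlt.trans_le (le_uncenteredMaximal hy hpos)

theorem uncenteredMaximal_congr_enorm {f g : X → ℝ} (h : ∀ᵐ x ∂μ, ‖f x‖ₑ = ‖g x‖ₑ) :
    uncenteredMaximal μ f = uncenteredMaximal μ g := by
  funext x
  unfold uncenteredMaximal
  simp_rw [fun c r ↦ lintegral_congr_ae (ae_restrict_of_ae (s := ball c r) h)]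

theorem le_uncenteredMaximal_of_setIntegral_nonneg {g : X → ℝ}
    (hg0 : 0 ≤ g) {t : ℝ} (ht : 0 ≤ t) {c x : X} {r : ℝ} (hint : IntegrableOn g (ball c r) μ)
    (hfin : μ (ball c r) ≠ ∞) (hne : μ (ball c r) ≠ 0)
    (hnonneg : 0 ≤ ∫ y in ball c r, (g y - t) ∂μ) (hx : x ∈ ball c r) :
    ENNReal.ofReal t ≤ uncenteredMaximal μ g x := by
  refine le_trans ?_ (le_uncenteredMaximal hx (pos_iff_ne_zero.2 hne))
  have h1 : t * μ.real (ball c r) ≤ ∫ y in ball c r, g y ∂μ := by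
    rw [integral_sub hint (integrableOn_const hfin), setIntegral_const, smul_eq_mul] at hnonneg
    linarith
  have h2 : ENNReal.ofReal t * μ (ball c r) ≤ ∫⁻ y in ball c r, ‖g y‖ₑ ∂μ := by
    rw [← ofReal_integral_norm_eq_lintegral_enorm hint]
    simp_rw [Real.norm_of_nonneg (hg0 _)]
    refine le_trans (le_of_eq ?_) (ENNReal.ofReal_le_ofReal h1)
    rw [ENNReal.ofReal_mul ht, Measure.real, ENNReal.ofReal_toReal hfin]
  calc ENNReal.ofReal t = (μ (ball c r))⁻¹ * (ENNReal.ofReal t * μ (ball c r)) := by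
        rw [mul_comm, mul_assoc, ENNReal.mul_inv_cancel hne hfin, mul_one]
    _ ≤ _ := by gcongr

end MaximalFunction

/-! ### The estimate at a fixed level -/

theorem lintegral_ofReal_eq_of_integral_eq_zero {X : Type*} [MeasurableSpace X] {μ : Measure X}
    {h : X → ℝ} (hh : Integrable h μ) (h0 : ∫ y, h y ∂μ = 0) :
    ∫⁻ y, ENNReal.ofReal (h y) ∂μ = ∫⁻ y, ENNReal.ofReal (-h y) ∂μ := by
  rw [integral_eq_lintegral_pos_part_sub_lintegral_neg_part hh, sub_eq_zero] at h0
  exact (ENNReal.toReal_eq_toReal_iff' hh.lintegral_lt_top.ne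
    hh.neg.lintegral_lt_top.ne).1 h0

/-- The basic estimate for a finite, separated family of discs which can be perturbed to discs over
which the mean of `g` is exactly `t`. -/
theorem setLIntegral_ofReal_sub_le_of_finset {μ : Measure ℝ²} [IsLocallyFiniteMeasure μ]
    (hμ : ∀ x, μ {x} = 0) {g : ℝ² → ℝ} (hg : Measurable g) (hg0 : 0 ≤ g)
    (hloc : LocallyIntegrable g μ) {t : ℝ} (ht : 0 < t)
    (S : Finset (ℝ² × ℝ)) (hpos : ∀ q ∈ S, 0 < q.2)
    (hsep : ∀ p ∈ S, ∀ q ∈ S, p ≠ q → p.2 ≤ dist p.1 q.1)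
    (hzero : ∀ q ∈ S, ∀ ε > 0, ∃ d ∈ ball q ε, ∫ y in ball d.1 d.2, (g y - t) ∂μ = 0)
    {K : Set ℝ²} (hKm : MeasurableSet K) (hK : ∀ x ∈ K, ∃ q ∈ S, x ∈ ball q.1 q.2) :
    ∫⁻ x in K, ENNReal.ofReal (g x - t) ∂μ ≤
      5 * ENNReal.ofReal t *
        μ ({x | ENNReal.ofReal t ≤ uncenteredMaximal μ g x} \ {x | t < g x}) := by
  classical
  have : NullSingletonClass μ := ⟨fun x ↦ hμ x⟩
  set W := {x | ENNReal.ofReal t ≤ uncenteredMaximal μ g x}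
  set A := {x | t < g x}
  have hWm : MeasurableSet W := measurableSet_le measurable_const (measurable_uncenteredMaximal g)
  have hAm : MeasurableSet A := measurableSet_lt measurable_const hg
  let G : ℝ² → ℝ≥0∞ := fun x ↦ ENNReal.ofReal (g x - t)
  let H : ℝ² → ℝ≥0∞ := fun x ↦ ENNReal.ofReal (t - g x)
  have hGm : Measurable G := (hg.sub_const t).ennreal_ofReal
  have hHm : Measurable H := (measurable_const.sub hg).ennreal_ofReal
  have hHt : ∀ x, H x ≤ ENNReal.ofReal t := fun x ↦
    ENNReal.ofReal_le_ofReal (by linarith [show 0 ≤ g x from hg0 x])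
  have hintB : ∀ q : ℝ² × ℝ, IntegrableOn g (ball q.1 q.2) μ := fun q ↦
    (hloc.integrableOn_isCompact (isCompact_closedBall q.1 q.2)).mono_set ball_subset_closedBall
  have hex : ∀ (n : ℕ) (q : ℝ² × ℝ), ∃ d, q ∈ S →
      d ∈ ball q (1 / ((n : ℝ) + 1)) ∧ ∫ y in ball d.1 d.2, (g y - t) ∂μ = 0 := by
    intro n q
    by_cases hq : q ∈ S
    · obtain ⟨d, hd⟩ := hzero q hq (1 / ((n : ℝ) + 1)) (by positivity)
      exact ⟨d, fun _ ↦ hd⟩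
    · exact ⟨q, fun h ↦ absurd h hq⟩
  choose d hd using hex
  have hdlim : ∀ q ∈ S, Tendsto (fun n ↦ d n q) atTop (𝓝 q) := fun q hq ↦
    tendsto_iff_dist_tendsto_zero.2 <| squeeze_zero (fun _ ↦ dist_nonneg)
      (fun n ↦ (mem_ball.1 (hd n q hq).1).le) tendsto_one_div_add_atTop_nhds_zero_nat
  have hd1 : ∀ q ∈ S, Tendsto (fun n ↦ (d n q).1) atTop (𝓝 q.1) := fun q hq ↦
    (continuous_fst.tendsto q).comp (hdlim q hq)
  have hd2 : ∀ q ∈ S, Tendsto (fun n ↦ (d n q).2) atTop (𝓝 q.2) := fun q hq ↦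
    (continuous_snd.tendsto q).comp (hdlim q hq)
  let D : ℕ → ℝ² × ℝ → Set ℝ² := fun n q ↦ ball (d n q).1 (d n q).2
  have hDm : ∀ n q, MeasurableSet (D n q) := fun n q ↦ measurableSet_ball
  -- `F` counts the deficit with multiplicity over the perturbed discs; `L` is the excess on their
  -- union.
  let F : ℕ → ℝ² → ℝ≥0∞ := fun n x ↦ ∑ q ∈ S, (D n q).indicator H x
  let L : ℕ → ℝ² → ℝ≥0∞ := fun n ↦ (⋃ q ∈ S, D n q).indicator G
  have hUm : ∀ n, MeasurableSet (⋃ q ∈ S, D n q) := fun n ↦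
    S.measurableSet_biUnion fun q _ ↦ hDm n q
  have hLF : ∀ n, ∫⁻ x, L n x ∂μ ≤ ∫⁻ x, F n x ∂μ := by
    intro n
    calc ∫⁻ x, L n x ∂μ ≤ ∫⁻ x, ∑ q ∈ S, (D n q).indicator G x ∂μ := by
          refine lintegral_mono (Set.indicator_le fun x hx ↦ ?_)
          obtain ⟨q, hq, hxq⟩ := Set.mem_iUnion₂.1 hx
          rw [← Set.indicator_of_mem hxq G]
          exact Finset.single_le_sum (f := fun q ↦ (D n q).indicator G x)
            (fun _ _ ↦ zero_le) hq
      _ = ∑ q ∈ S, ∫⁻ x in D n q, G x ∂μ := by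
        rw [lintegral_finsetSum _ fun q _ ↦ hGm.indicator (hDm n q)]
        exact Finset.sum_congr rfl fun q _ ↦ lintegral_indicator (hDm n q) _
      _ = ∑ q ∈ S, ∫⁻ x in D n q, H x ∂μ := by
        refine Finset.sum_congr rfl fun q hq ↦ ?_
        have := lintegral_ofReal_eq_of_integral_eq_zero
          ((hintB (d n q)).sub (integrableOn_const measure_ball_lt_top.ne)) (hd n q hq).2
        simpa only [Pi.sub_apply, neg_sub] using this
      _ = ∫⁻ x, F n x ∂μ := by
        rw [lintegral_finsetSum _ fun q _ ↦ hHm.indicator (hDm n q)]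
        exact Finset.sum_congr rfl fun q _ ↦ (lintegral_indicator (hDm n q) _).symm
  have hDW : ∀ᵐ x ∂μ, ∀ n, ∀ q ∈ S, x ∈ D n q → x ∈ W := by
    rw [ae_all_iff]
    intro n
    rw [Finset.eventually_all]
    intro q hq
    rcases eq_or_ne (μ (D n q)) 0 with h0 | h0
    · filter_upwards [measure_eq_zero_iff_ae_notMem.1 h0] with x hx hx'
      exact absurd hx' hx
    · exact Eventually.of_forall fun x hx ↦ le_uncenteredMaximal_of_setIntegral_nonneg hg0 ht.le
        (hintB (d n q)) measure_ball_lt_top.ne h0 (hd n q hq).2.ge hx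
  obtain ⟨Z, hZ, hZ5⟩ := exists_finite_forall_card_le_five S hpos hsep
  have hlimsup : ∀ᵐ x ∂μ, limsup (fun n ↦ F n x) atTop ≤
      (W \ A).indicator (fun _ ↦ 5 * ENNReal.ofReal t) x := by
    filter_upwards [hDW, measure_eq_zero_iff_ae_notMem.1 (hZ.measure_zero μ)] with x hxW hxZ
    refine limsup_le_of_le (by isBoundedDefault) ?_
    let T := S.filter fun q ↦ x ∈ closedBall q.1 q.2
    have hT5 : T.card ≤ 5 := hZ5 x hxZ T (Finset.filter_subset _ _)
      fun q hq ↦ (Finset.mem_filter.1 hq).2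
    -- The perturbed discs need not be separated, but those containing x eventually come from closed
    -- discs of `S` containing x, where the bound five applies.
    have hev : ∀ᶠ n in atTop, ∀ q ∈ S, x ∈ D n q → q ∈ T := by
      rw [Finset.eventually_all]
      intro q hq
      by_cases hxq : x ∈ closedBall q.1 q.2
      · exact Eventually.of_forall fun _ _ ↦ Finset.mem_filter.2 ⟨hq, hxq⟩
      · filter_upwards [eventually_notMem_ball (hd1 q hq) (hd2 q hq) hxq] with n hn h
        exact absurd h hn
    filter_upwards [hev] with n hn
    by_cases hxWA : x ∈ W \ A
    · rw [Set.indicator_of_mem hxWA]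
      calc F n x ≤ ∑ q ∈ S, if q ∈ T then ENNReal.ofReal t else 0 := by
            refine Finset.sum_le_sum fun q hq ↦ ?_
            by_cases hxD : x ∈ D n q
            · rw [Set.indicator_of_mem hxD, if_pos (hn q hq hxD)]
              exact hHt x
            · rw [Set.indicator_of_notMem hxD]
              exact zero_le
        _ = T.card * ENNReal.ofReal t := by
            rw [← Finset.sum_filter, Finset.sum_const, nsmul_eq_mul]
            congr 3
            ext q
            simp [T]
        _ ≤ 5 * ENNReal.ofReal t := by
            gcongr
            exact_mod_cast hT5
    · rw [Set.indicator_of_notMem hxWA]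
      refine le_of_eq (Finset.sum_eq_zero fun q hq ↦ ?_)
      by_cases hxD : x ∈ D n q
      · rw [Set.indicator_of_mem hxD]
        have hxA : x ∈ A := by
          by_contra hxA
          exact hxWA ⟨hxW n q hq hxD, hxA⟩
        exact ENNReal.ofReal_of_nonpos (by linarith [show t < g x from hxA])
      · exact Set.indicator_of_notMem hxD _
  have hliminf : ∀ x, K.indicator G x ≤ liminf (fun n ↦ L n x) atTop := by
    intro x
    by_cases hxK : x ∈ K
    · obtain ⟨q, hq, hxq⟩ := hK x hxK
      refine le_liminf_of_le (by isBoundedDefault) ?_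
      filter_upwards [eventually_mem_ball (hd1 q hq) (hd2 q hq) hxq] with n hn
      have : x ∈ ⋃ q ∈ S, D n q := Set.mem_biUnion (show q ∈ (S : Set _) from hq) hn
      rw [Set.indicator_of_mem hxK, show L n x = G x from Set.indicator_of_mem this _]
    · rw [Set.indicator_of_notMem hxK]
      exact zero_le
  -- Centre and radius each move by less than 1; this gives an integrable majorant for the reverse
  -- Fatou lemma.
  have hD : ∀ n, ∀ q ∈ S, D n q ⊆ ball q.1 (q.2 + 2) := by
    intro n q hq y hy
    have h1 := (hd n q hq).1
    rw [mem_ball, Prod.dist_eq, sup_lt_iff, Real.dist_eq] at h1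
    have h2 : 1 / ((n : ℝ) + 1) ≤ 1 := by
      rw [div_le_one (by positivity)]; linarith [(Nat.cast_nonneg n : (0 : ℝ) ≤ n)]
    have h3 := (abs_lt.1 h1.2).2
    have h4 := mem_ball.1 hy
    rw [mem_ball]
    linarith [dist_triangle y (d n q).1 q.1, h1.1]
  have hfatou : limsup (fun n ↦ ∫⁻ x, F n x ∂μ) atTop ≤ ∫⁻ x, limsup (fun n ↦ F n x) atTop ∂μ := by
    refine limsup_lintegral_le
      (fun x ↦ ∑ q ∈ S, (ball q.1 (q.2 + 2)).indicator (fun _ ↦ ENNReal.ofReal t) x)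
      (fun n ↦ Finset.measurable_fun_sum _ fun q _ ↦ hHm.indicator (hDm n q))
      (fun n ↦ Eventually.of_forall fun x ↦ Finset.sum_le_sum fun q hq ↦ ?_) ?_
    · exact (Set.indicator_le_indicator (hHt x)).trans <|
        Set.indicator_le_indicator_of_subset (hD n q hq) (fun _ ↦ zero_le) x
    · rw [lintegral_finsetSum _ fun q _ ↦ measurable_const.indicator measurableSet_ball]
      refine (ENNReal.sum_lt_top.2 fun q _ ↦ ?_).ne
      rw [lintegral_indicator measurableSet_ball, setLIntegral_const]
      exact ENNReal.mul_lt_top ENNReal.ofReal_lt_top measure_ball_lt_top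
  calc ∫⁻ x in K, G x ∂μ = ∫⁻ x, K.indicator G x ∂μ := (lintegral_indicator hKm _).symm
    _ ≤ ∫⁻ x, liminf (fun n ↦ L n x) atTop ∂μ := lintegral_mono hliminf
    _ ≤ liminf (fun n ↦ ∫⁻ x, L n x ∂μ) atTop :=
      lintegral_liminf_le fun n ↦ hGm.indicator (hUm n)
    _ ≤ liminf (fun n ↦ ∫⁻ x, F n x ∂μ) atTop := liminf_le_liminf (Eventually.of_forall hLF)
    _ ≤ limsup (fun n ↦ ∫⁻ x, F n x ∂μ) atTop := liminf_le_limsup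
    _ ≤ ∫⁻ x, limsup (fun n ↦ F n x) atTop ∂μ := hfatou
    _ ≤ ∫⁻ x, (W \ A).indicator (fun _ ↦ 5 * ENNReal.ofReal t) x ∂μ := lintegral_mono_ae hlimsup
    _ = 5 * ENNReal.ofReal t * μ (W \ A) := by
      rw [lintegral_indicator (hWm.diff hAm), setLIntegral_const]

/-- By Lebesgue differentiation, almost every point of `{g > t}` is the centre of a ball over which
the mean of `g` exceeds `t`. -/
theorem ae_exists_setIntegral_ball_pos {μ : Measure ℝ²} [IsLocallyFiniteMeasure μ] {g : ℝ² → ℝ}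
    (hloc : LocallyIntegrable g μ) {t : ℝ} (ht : 0 < t) :
    ∀ᵐ x ∂μ, t < g x → ∃ r > 0, 0 < ∫ y in ball x r, (g y - t) ∂μ := by
  filter_upwards [(Besicovitch.vitaliFamily μ).ae_tendsto_average hloc] with x hx hxt
  have h1 := (hx.comp (Besicovitch.tendsto_filterAt μ x)).eventually (Ioi_mem_nhds hxt)
  obtain ⟨r, hr, hr0⟩ := (h1.and self_mem_nhdsWithin).exists
  have hr0 : 0 < r := hr0
  have hfin : μ (closedBall x r) ≠ ∞ := (isCompact_closedBall x r).measure_lt_top.ne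
  have hr : t < ⨍ y in closedBall x r, g y ∂μ := hr
  rw [setAverage_eq, smul_eq_mul] at hr
  have hpos : 0 < μ.real (closedBall x r) := by
    refine lt_of_le_of_ne measureReal_nonneg fun h0 ↦ ?_
    rw [← h0, inv_zero, zero_mul] at hr
    exact absurd hr ht.not_gt
  have h2 : 0 < ∫ y in closedBall x r, (g y - t) ∂μ := by
    rw [integral_sub (hloc.integrableOn_isCompact (isCompact_closedBall x r))
      (integrableOn_const hfin), setIntegral_const, smul_eq_mul, sub_pos]
    rwa [inv_mul_eq_div, lt_div_iff₀ hpos, mul_comm] at hr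
  have h3 := (tendsto_setIntegral_ball_right (hloc.sub (locallyIntegrable_const t)) x r).eventually
    (Ioi_mem_nhds h2)
  obtain ⟨s, hs, hsr⟩ := (h3.and self_mem_nhdsWithin).exists
  exact ⟨s, hr0.trans hsr, hs⟩

/-- In a space of infinite measure, balls with bounded measure and centres in a bounded set have
bounded radii. -/
theorem exists_radius_bound {X : Type*} [PseudoMetricSpace X] [MeasurableSpace X] {μ : Measure X}
    (hinf : μ Set.univ = ∞) (a : X) (ρ A : ℝ) :
    ∃ R, ∀ c r, dist c a ≤ ρ → μ (ball c r) ≤ ENNReal.ofReal A → r ≤ R := by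
  have hlim : Tendsto (fun n : ℕ ↦ μ (ball a n)) atTop (𝓝 ∞) := by
    rw [← hinf, ← iUnion_ball_nat a]
    exact tendsto_measure_iUnion_atTop fun m n hmn ↦ ball_subset_ball (by exact_mod_cast hmn)
  obtain ⟨m, hm⟩ := (hlim.eventually (Ioi_mem_nhds ENNReal.ofReal_lt_top)).exists
  refine ⟨ρ + m, fun c r hc hle ↦ ?_⟩
  by_contra! hr
  have hsub : ball a m ⊆ ball c r := ball_subset_ball' (by rw [dist_comm]; linarith)
  exact absurd ((measure_mono hsub).trans hle) (not_le.2 hm)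

/-- The key estimate: the excess of `g` over the level `t` is controlled by the measure of the set
that the maximal function adds to `{g > t}`. -/
theorem lintegral_ofReal_sub_le {μ : Measure ℝ²} [IsLocallyFiniteMeasure μ]
    (hμ : ∀ x, μ {x} = 0) (hinf : μ Set.univ = ∞) {g : ℝ² → ℝ} (hg : Measurable g) (hg0 : 0 ≤ g)
    (hloc : LocallyIntegrable g μ) {t : ℝ} (ht : 0 < t) {A : ℝ}
    (hA : ∀ c r, 0 < ∫ y in ball c r, (g y - t) ∂μ → μ (ball c r) ≤ ENNReal.ofReal A) :
    ∫⁻ x, ENNReal.ofReal (g x - t) ∂μ ≤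
      5 * ENNReal.ofReal t *
        μ ({x | ENNReal.ofReal t ≤ uncenteredMaximal μ g x} \ {x | t < g x}) := by
  set F := closure {q : ℝ² × ℝ | 0 < ∫ y in ball q.1 q.2, (g y - t) ∂μ} with hF
  have hlocsub : LocallyIntegrable (fun y ↦ g y - t) μ := hloc.sub (locallyIntegrable_const t)
  have hbound : ∀ ρ : ℝ, ∃ R, ∀ q ∈ F, dist q.1 0 ≤ ρ → q.2 ≤ R := by
    intro ρ
    obtain ⟨R, hR⟩ := exists_radius_bound hinf (0 : ℝ²) (ρ + 1) A
    refine ⟨R, fun q hq hqρ ↦ ?_⟩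
    by_contra! hlt
    obtain ⟨q', ⟨h1, h2⟩, h3⟩ := mem_closure_iff.1 hq (ball 0 (ρ + 1) ×ˢ Set.Ioi R)
      (isOpen_ball.prod isOpen_Ioi) ⟨by rw [mem_ball]; linarith, hlt⟩
    exact absurd (hR q'.1 q'.2 (mem_ball.1 h1).le (hA _ _ h3)) (not_le.2 h2)
  -- Radii are cut off only from below; `hbound` bounds them from above. A larger concentric member
  -- of `F` thus stays in `P n`, so maximality in `P n` is maximality in `F`.
  let P : ℕ → Set (ℝ² × ℝ) := fun n ↦ F ∩ closedBall 0 n ×ˢ Set.Ici (1 / ((n : ℝ) + 1))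
  have hP : ∀ n, IsCompact (P n) := by
    intro n
    obtain ⟨R, hR⟩ := hbound n
    refine ((isCompact_closedBall (0 : ℝ²) n).prod
      (isCompact_Icc (a := 1 / ((n : ℝ) + 1)) (b := R))).of_isClosed_subset
      (isClosed_closure.inter (isClosed_closedBall.prod isClosed_Ici)) ?_
    exact fun q hq ↦ ⟨hq.2.1, hq.2.2, hR q hq.1 hq.2.1⟩
  have hPmono : Monotone P := fun m n hmn ↦ Set.inter_subset_inter_right _ <|
    Set.prod_mono (closedBall_subset_closedBall (by exact_mod_cast hmn))
      (Set.Ici_subset_Ici.2 (one_div_le_one_div_of_le (by positivity) (by gcongr)))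
  let K : ℕ → Set ℝ² := fun n ↦ Prod.fst '' P n
  have hKmono : Monotone K := fun m n hmn ↦ Set.image_mono (hPmono hmn)
  have hKm : ∀ n, MeasurableSet (K n) := fun n ↦ ((hP n).image continuous_fst).measurableSet
  have hK : ∀ n, ∫⁻ x in K n, ENNReal.ofReal (g x - t) ∂μ ≤ 5 * ENNReal.ofReal t *
      μ ({x | ENNReal.ofReal t ≤ uncenteredMaximal μ g x} \ {x | t < g x}) := by
    intro n
    have hδ : 0 < 1 / ((n : ℝ) + 1) := by positivity
    obtain ⟨S, hSP, hsep, hmax, hcov⟩ :=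
      exists_finset_separated_cover (hP n) hδ fun q hq ↦ hq.2.2
    refine setLIntegral_ofReal_sub_le_of_finset hμ hg hg0 hloc ht S
      (fun q hq ↦ hδ.trans_le (hSP q hq).2.2) hsep (fun q hq ε hε ↦ ?_) (hKm n) ?_
    · refine exists_setIntegral_ball_eq_zero hμ hlocsub (hSP q hq).1 (fun r hr hmem ↦ ?_) hε
      exact absurd (hmax q hq r ⟨hmem, (hSP q hq).2.1, (hSP q hq).2.2.trans (le_of_lt hr)⟩)
        (not_le.2 hr)
    · rintro _ ⟨p, hp, rfl⟩
      exact hcov p hp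
  have hUm : MeasurableSet (⋃ n, K n) := MeasurableSet.iUnion hKm
  have hae : ∀ᵐ x ∂μ, t < g x → x ∈ ⋃ n, K n := by
    filter_upwards [ae_exists_setIntegral_ball_pos hloc ht] with x hx hxt
    obtain ⟨r, hr, hpos⟩ := hx hxt
    obtain ⟨m, hm⟩ := exists_nat_ge (dist x 0)
    obtain ⟨k, hk⟩ := exists_nat_one_div_lt hr
    refine Set.mem_iUnion.2 ⟨max m k, (x, r), ⟨subset_closure hpos, ?_, ?_⟩, rfl⟩
    · exact hm.trans (by exact_mod_cast le_max_left m k)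
    · refine le_trans (one_div_le_one_div_of_le (by positivity) ?_) hk.le
      have : (k : ℝ) ≤ (max m k : ℕ) := by exact_mod_cast le_max_right m k
      linarith
  calc ∫⁻ x, ENNReal.ofReal (g x - t) ∂μ
      = ∫⁻ x, (⋃ n, K n).indicator (fun x ↦ ENNReal.ofReal (g x - t)) x ∂μ := by
        refine lintegral_congr_ae ?_
        filter_upwards [hae] with x hx
        by_cases hxK : x ∈ ⋃ n, K n
        · rw [Set.indicator_of_mem hxK]
        · rw [Set.indicator_of_notMem hxK]
          exact ENNReal.ofReal_of_nonpos (by linarith [not_lt.1 (mt hx hxK)])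
    _ = ⨆ n, ∫⁻ x in K n, ENNReal.ofReal (g x - t) ∂μ := by
        rw [lintegral_indicator hUm, setLIntegral_iUnion_of_directed _ hKmono.directed_le]
    _ ≤ _ := iSup_le hK

/-- Chebyshev's inequality for the discs over which the mean of `g` exceeds `t`. -/
theorem measure_ball_le_of_setIntegral_pos {X : Type*} [PseudoMetricSpace X] [ProperSpace X]
    [MeasurableSpace X] [BorelSpace X] {μ : Measure X} [IsLocallyFiniteMeasure μ]
    {g : X → ℝ} (hg0 : 0 ≤ g)
    (hloc : LocallyIntegrable g μ) {p : ℝ} (hp : 1 < p) (hgp : Integrable (fun x ↦ g x ^ p) μ)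
    {t : ℝ} (ht : 0 < t) {c : X} {r : ℝ} (hpos : 0 < ∫ y in ball c r, (g y - t) ∂μ) :
    μ (ball c r) ≤ ENNReal.ofReal (2 / t * ((t / 2) ^ (1 - p) * ∫ x, g x ^ p ∂μ)) := by
  have hfin : μ (ball c r) ≠ ∞ := measure_ball_lt_top.ne
  have hint : IntegrableOn g (ball c r) μ :=
    (hloc.integrableOn_isCompact (isCompact_closedBall c r)).mono_set ball_subset_closedBall
  have ht2 : 0 < t / 2 := half_pos ht
  rw [integral_sub hint (integrableOn_const hfin), setIntegral_const, smul_eq_mul] at hpos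
  -- Splitting at t/2 leaves half of t μ(B) to absorb on the left.
  have hpt : ∀ x, g x ≤ t / 2 + (t / 2) ^ (1 - p) * g x ^ p := by
    intro x
    have hgx : 0 ≤ g x := hg0 x
    rcases le_or_gt (g x) (t / 2) with h | h
    · have : 0 ≤ (t / 2) ^ (1 - p) * g x ^ p := by positivity
      linarith
    · have hx0 : 0 < g x := ht2.trans h
      have h1 : g x ^ (1 - p) ≤ (t / 2) ^ (1 - p) :=
        Real.rpow_le_rpow_of_nonpos ht2 h.le (by linarith)
      have h2 : g x ^ (1 - p) * g x ^ p = g x := by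
        rw [← Real.rpow_add hx0]; simp
      have h3 : g x ^ (1 - p) * g x ^ p ≤ (t / 2) ^ (1 - p) * g x ^ p := by gcongr
      linarith
  have h1 : ∫ y in ball c r, g y ∂μ ≤
      μ.real (ball c r) * (t / 2) + (t / 2) ^ (1 - p) * ∫ x, g x ^ p ∂μ := by
    calc ∫ y in ball c r, g y ∂μ
        ≤ ∫ y in ball c r, (t / 2 + (t / 2) ^ (1 - p) * g y ^ p) ∂μ :=
          integral_mono hint ((integrableOn_const hfin).add (hgp.integrableOn.const_mul _)) hpt
      _ = μ.real (ball c r) * (t / 2) + (t / 2) ^ (1 - p) * ∫ y in ball c r, g y ^ p ∂μ := by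
          rw [integral_add (μ := μ.restrict (ball c r)) (f := fun _ ↦ t / 2)
            (integrableOn_const hfin) (hgp.integrableOn.const_mul _),
            setIntegral_const, smul_eq_mul, integral_const_mul]
      _ ≤ _ := by
          gcongr
          · exact Eventually.of_forall fun x ↦ Real.rpow_nonneg (hg0 x) p
          · exact Measure.restrict_le_self
  rw [← ENNReal.ofReal_toReal hfin]
  refine ENNReal.ofReal_le_ofReal ?_
  change μ.real (ball c r) ≤ _
  rw [div_mul_eq_mul_div, le_div_iff₀ ht]
  linarith

/-- Almost everywhere on `{g > t}` the maximal function of `g` is at least `t`. -/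
theorem ae_le_uncenteredMaximal_of_lt {μ : Measure ℝ²} [IsLocallyFiniteMeasure μ] {g : ℝ² → ℝ}
    (hg0 : 0 ≤ g) (hloc : LocallyIntegrable g μ) {t : ℝ} (ht : 0 < t) :
    ∀ᵐ x ∂μ, t < g x → ENNReal.ofReal t ≤ uncenteredMaximal μ g x := by
  filter_upwards [ae_exists_setIntegral_ball_pos hloc ht] with x hx hxt
  obtain ⟨r, hr, hpos⟩ := hx hxt
  refine le_uncenteredMaximal_of_setIntegral_nonneg hg0 ht.le
    ((hloc.integrableOn_isCompact (isCompact_closedBall x r)).mono_set ball_subset_closedBall)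
    measure_ball_lt_top.ne (fun h0 ↦ ?_) hpos.le (mem_ball_self hr)
  rw [Measure.restrict_zero_set h0, integral_zero_measure] at hpos
  exact lt_irrefl _ hpos

/-- The key estimate as an inequality between distribution functions. -/
theorem withDensity_add_le {μ : Measure ℝ²} [IsLocallyFiniteMeasure μ]
    (hμ : ∀ x, μ {x} = 0) (hinf : μ Set.univ = ∞) {g : ℝ² → ℝ} (hg : Measurable g) (hg0 : 0 ≤ g)
    (hloc : LocallyIntegrable g μ) {p : ℝ} (hp : 1 < p) (hgp : Integrable (fun x ↦ g x ^ p) μ)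
    {t : ℝ} (ht : 0 < t) :
    μ.withDensity (fun x ↦ ENNReal.ofReal (g x)) {x | t < g x} +
        4 * (ENNReal.ofReal t * μ {x | t < g x}) ≤
      5 * (ENNReal.ofReal t * μ {x | ENNReal.ofReal t ≤ uncenteredMaximal μ g x}) := by
  have key := lintegral_ofReal_sub_le hμ hinf hg hg0 hloc ht
    fun c r ↦ measure_ball_le_of_setIntegral_pos hg0 hloc hp hgp ht
  have hae := ae_le_uncenteredMaximal_of_lt hg0 hloc ht
  set W := {x | ENNReal.ofReal t ≤ uncenteredMaximal μ g x}
  set A := {x | t < g x}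
  have hAm : MeasurableSet A := measurableSet_lt measurable_const hg
  have h1 : μ.withDensity (fun x ↦ ENNReal.ofReal (g x)) A ≤
      ∫⁻ x, ENNReal.ofReal (g x - t) ∂μ + ENNReal.ofReal t * μ A := by
    rw [withDensity_apply _ hAm]
    calc ∫⁻ x in A, ENNReal.ofReal (g x) ∂μ
        ≤ ∫⁻ x in A, (ENNReal.ofReal (g x - t) + ENNReal.ofReal t) ∂μ := by
          refine lintegral_mono fun x ↦ ?_
          simpa using ENNReal.ofReal_add_le (p := g x - t) (q := t)
      _ = ∫⁻ x in A, ENNReal.ofReal (g x - t) ∂μ + ENNReal.ofReal t * μ A := by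
          rw [lintegral_add_right _ measurable_const, setLIntegral_const]
      _ ≤ _ := by gcongr; exact Measure.restrict_le_self
  have h2 : μ (W \ A) + μ A ≤ μ W := by
    rw [← measure_sdiff_add_inter W hAm]
    refine add_le_add le_rfl (measure_mono_ae ?_)
    filter_upwards [hae] with x hx hxA
    exact ⟨hx hxA, hxA⟩
  calc μ.withDensity (fun x ↦ ENNReal.ofReal (g x)) A + 4 * (ENNReal.ofReal t * μ A)
      ≤ 5 * ENNReal.ofReal t * μ (W \ A) + ENNReal.ofReal t * μ A +
          4 * (ENNReal.ofReal t * μ A) := by gcongr; exact h1.trans (by gcongr)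
    _ = 5 * (ENNReal.ofReal t * (μ (W \ A) + μ A)) := by ring
    _ ≤ _ := by gcongr

/-! ### Integration over the levels -/

/-- The lower bound for the maximal function at the level of `p`-th powers. -/
theorem mul_lintegral_rpow_le_lintegral_uncenteredMaximal {μ : Measure ℝ²}
    [IsLocallyFiniteMeasure μ] (hμ : ∀ x, μ {x} = 0) (hinf : μ Set.univ = ∞)
    {g : ℝ² → ℝ} (hg : Measurable g) (hg0 : 0 ≤ g) (hloc : LocallyIntegrable g μ)
    {p : ℝ} (hp : 1 < p) (hgp : Integrable (fun x ↦ g x ^ p) μ) :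
    ENNReal.ofReal (1 + 1 / (5 * (p - 1))) * ∫⁻ x, ENNReal.ofReal (g x ^ p) ∂μ ≤
      ∫⁻ x, uncenteredMaximal μ g x ^ p ∂μ := by
  have hp0 : 0 < p := one_pos.trans hp
  have hp1 : 0 < p - 1 := sub_pos.2 hp
  have hMm := measurable_uncenteredMaximal (μ := μ) g
  rcases eq_or_ne (∫⁻ x, uncenteredMaximal μ g x ^ p ∂μ) ∞ with htop | htop
  · rw [htop]; exact le_top
  have hfin : ∀ᵐ x ∂μ, uncenteredMaximal μ g x ≠ ∞ := by
    filter_upwards [ae_lt_top (hMm.pow_const p) htop] with x hx hx'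
    rw [hx', ENNReal.top_rpow_of_pos hp0] at hx
    exact lt_irrefl _ hx
  set m : ℝ² → ℝ := fun x ↦ (uncenteredMaximal μ g x).toReal
  have hm : ∫⁻ x, uncenteredMaximal μ g x ^ p ∂μ = ∫⁻ x, ENNReal.ofReal (m x ^ p) ∂μ := by
    refine lintegral_congr_ae ?_
    filter_upwards [hfin] with x hx
    rw [← ENNReal.ofReal_rpow_of_nonneg ENNReal.toReal_nonneg hp0.le, ENNReal.ofReal_toReal hx]
  have hlevel : ∀ t : ℝ, μ {x | ENNReal.ofReal t ≤ uncenteredMaximal μ g x} = μ {x | t ≤ m x} := by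
    intro t
    refine measure_congr ?_
    filter_upwards [hfin] with x hx
    exact propext (ENNReal.ofReal_le_iff_le_toReal hx)
  -- The layer-cake formula for g^(p-1) against g dμ produces the factor p/(p-1) from the term ∫_A g
  -- dμ.
  let ν := μ.withDensity fun x ↦ ENNReal.ofReal (g x)
  have hcakeM := lintegral_rpow_eq_lintegral_meas_le_mul μ (f := m)
    (Eventually.of_forall fun x ↦ ENNReal.toReal_nonneg) hMm.ennreal_toReal.aemeasurable hp0
  have hcakeg := lintegral_rpow_eq_lintegral_meas_lt_mul μ (f := g)
    (Eventually.of_forall hg0) hg.aemeasurable hp0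
  have hcakeν := lintegral_rpow_eq_lintegral_meas_lt_mul ν (f := g)
    (Eventually.of_forall hg0) hg.aemeasurable hp1
  have hν : ∫⁻ x, ENNReal.ofReal (g x ^ (p - 1)) ∂ν = ∫⁻ x, ENNReal.ofReal (g x ^ p) ∂μ := by
    rw [lintegral_withDensity_eq_lintegral_mul _ hg.ennreal_ofReal
      (hg.pow_const _).ennreal_ofReal]
    refine lintegral_congr fun x ↦ ?_
    rw [Pi.mul_apply, ← ENNReal.ofReal_mul (hg0 x)]
    congr 1
    rw [← Real.rpow_one_add' (hg0 x) (by linarith)]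
    congr 1
    ring
  rw [hν] at hcakeν
  rw [hm]
  set I := ∫⁻ x, ENNReal.ofReal (g x ^ p) ∂μ
  set J := ∫⁻ x, ENNReal.ofReal (m x ^ p) ∂μ
  set a := ∫⁻ t in Set.Ioi (0 : ℝ), ν {x | t < g x} * ENNReal.ofReal (t ^ (p - 1 - 1))
  set b := ∫⁻ t in Set.Ioi (0 : ℝ), μ {x | t < g x} * ENNReal.ofReal (t ^ (p - 1))
  set c := ∫⁻ t in Set.Ioi (0 : ℝ), μ {x | t ≤ m x} * ENNReal.ofReal (t ^ (p - 1))
  have hint : a + 4 * b ≤ 5 * c := by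
    simp only [a, b, c]
    rw [← lintegral_const_mul' _ _ (by simp), ← lintegral_const_mul' _ _ (by simp)]
    -- Superadditivity of the lower integral suffices and requires no measurability in t.
    refine (le_lintegral_add _ _).trans (setLIntegral_mono' measurableSet_Ioi fun t ht ↦ ?_)
    have ht : 0 < t := ht
    have h := withDensity_add_le hμ hinf hg hg0 hloc hp hgp ht
    rw [hlevel] at h
    have hpow : ENNReal.ofReal (t ^ (p - 1)) =
        ENNReal.ofReal t * ENNReal.ofReal (t ^ (p - 1 - 1)) := by
      rw [← ENNReal.ofReal_mul ht.le, ← Real.rpow_one_add' ht.le (by linarith)]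
      congr 2
      ring
    rw [hpow]
    calc _ = (ν {x | t < g x} + 4 * (ENNReal.ofReal t * μ {x | t < g x})) *
          ENNReal.ofReal (t ^ (p - 1 - 1)) := by ring
      _ ≤ (5 * (ENNReal.ofReal t * μ {x | t ≤ m x})) * ENNReal.ofReal (t ^ (p - 1 - 1)) := by
          gcongr
      _ = _ := by ring
  have hpa : ENNReal.ofReal p * a = ENNReal.ofReal (p / (p - 1)) * I := by
    rw [hcakeν, ← mul_assoc, ← ENNReal.ofReal_mul (by positivity), div_mul_cancel₀ _ hp1.ne']
  have h5 : ENNReal.ofReal (p / (p - 1) + 4) * I ≤ ENNReal.ofReal 5 * J := by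
    rw [ENNReal.ofReal_add (by positivity) (by norm_num), add_mul, ← hpa, hcakeM, hcakeg]
    calc _ = ENNReal.ofReal p * (a + 4 * b) := by
            rw [ENNReal.ofReal_ofNat]; ring
      _ ≤ ENNReal.ofReal p * (5 * c) := by gcongr
      _ = _ := by rw [ENNReal.ofReal_ofNat]; ring
  calc ENNReal.ofReal (1 + 1 / (5 * (p - 1))) * I
      = ENNReal.ofReal (1 / 5) * (ENNReal.ofReal (p / (p - 1) + 4) * I) := by
        rw [← mul_assoc, ← ENNReal.ofReal_mul (by norm_num)]
        congr 2
        field_simp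
        ring
    _ ≤ ENNReal.ofReal (1 / 5) * (ENNReal.ofReal 5 * J) := by gcongr
    _ = J := by
        rw [← mul_assoc, ← ENNReal.ofReal_mul (by norm_num)]
        norm_num

theorem theorem1p3 (μ : Measure (EuclideanSpace ℝ (Fin 2))) [μ.Regular]
    (hatomless : ∀ x : EuclideanSpace ℝ (Fin 2), μ {x} = 0)
    (hinfinite : μ Set.univ = ∞)
    (p : ℝ) (hp : 1 < p)
    (f : EuclideanSpace ℝ (Fin 2) → ℝ) (hf : MemLp f (ENNReal.ofReal p) μ) :
    ENNReal.ofReal ((1 + 1 / (5 * (p - 1))) ^ (1 / p)) * eLpNorm f (ENNReal.ofReal p) μ ≤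
      eLpNorm (uncenteredMaximal μ f) (ENNReal.ofReal p) μ := by
  have hp0 : 0 < p := one_pos.trans hp
  have hp1 : 0 < p - 1 := sub_pos.2 hp
  have hpne : ENNReal.ofReal p ≠ 0 := by simpa using hp0
  let g : ℝ² → ℝ := fun x ↦ ‖hf.1.mk f x‖
  have hgf : ∀ᵐ x ∂μ, ‖f x‖ₑ = ‖g x‖ₑ := by
    filter_upwards [hf.1.ae_eq_mk] with x hx
    rw [enorm_norm, ← hx]
  have hg : Measurable g := hf.1.stronglyMeasurable_mk.measurable.norm
  have hg0 : 0 ≤ g := fun x ↦ norm_nonneg _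
  have hgL : MemLp g (ENNReal.ofReal p) μ := (hf.ae_eq hf.1.ae_eq_mk).norm
  have hloc : LocallyIntegrable g μ :=
    hgL.locallyIntegrable (by simpa using hp.le)
  have hgp : Integrable (fun x ↦ g x ^ p) μ := by
    have := hgL.integrable_norm_rpow hpne ENNReal.ofReal_ne_top
    rw [ENNReal.toReal_ofReal hp0.le] at this
    simpa only [Real.norm_of_nonneg (hg0 _)] using this
  have key :=
    mul_lintegral_rpow_le_lintegral_uncenteredMaximal hatomless hinfinite hg hg0 hloc hp hgp
  have hI : ∫⁻ x, ENNReal.ofReal (g x ^ p) ∂μ = ∫⁻ x, ‖f x‖ₑ ^ p ∂μ := by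
    refine lintegral_congr_ae ?_
    filter_upwards [hgf] with x hx
    rw [hx, Real.enorm_of_nonneg (hg0 x), ENNReal.ofReal_rpow_of_nonneg (hg0 x) hp0.le]
  rw [uncenteredMaximal_congr_enorm hgf,
    eLpNorm_eq_lintegral_rpow_enorm_toReal hpne ENNReal.ofReal_ne_top,
    eLpNorm_eq_lintegral_rpow_enorm_toReal hpne ENNReal.ofReal_ne_top, ENNReal.toReal_ofReal hp0.le,
    ← ENNReal.ofReal_rpow_of_nonneg (by positivity) (by positivity),
    ← ENNReal.mul_rpow_of_nonneg _ _ (by positivity), ← hI]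
  simp only [enorm_eq_self]
  gcongr
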